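/- Let $\Bbbk$ be a field of characteristic $0$ and $A$ a commutative $\Bbbk$-algebra. Let $\mathcal H$ be a (possibly noncommutative) Hopf algebroid, both of whose base algebras are $A$; that is, $\mathcal H$ is a unital $\Bbbk$-algebra with (i) a left bialgebroid structure $(s_l,t_l,\Delta_l,\varepsilon_l)$ over $A$: $s_l,t_l:A\to\mathcal H$ are algebra morphisms with commuting images; $\mathcal H$, with the bimodule structure $a\triangleright h\triangleleft b=s_l(a)t_l(b)h$, is an $A$-coring with comultiplication $\Delta_l(h)=h_{(1)}\otimes h_{(2)}$ and counit $\varepsilon_l$; $h_{(1)}t_l(a)\otimes h_{(2)}=h_{(1)}\otimes h_{(2)}s_l(a)$ for all $a\in A$, and $\Delta_l$ is unital and multiplicative; $\varepsilon_l(hk)=\varepsilon_l(hs_l(\varepsilon_l(k)))=\varepsilon_l(ht_l(\varepsilon_l(k)))$; (ii) a right bialgebroid structure $(s_r,t_r,\Delta_r,\varepsilon_r)$ over $A$: $s_r,t_r:A\to\mathcal H$ are algebra morphisms with commuting images; $\mathcal H$, with the bimodule structure $a\blacktriangleright h\blacktriangleleft b=ht_r(a)s_r(b)$, is an $A$-coring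 with comultiplication $\Delta_r(h)=h^{(1)}\otimes h^{(2)}$ and counit $\varepsilon_r$; $s_r(a)h^{(1)}\otimes h^{(2)}=h^{(1)}\otimes t_r(a)h^{(2)}$ for all $a\in A$, and $\Delta_r$ is unital and multiplicative; $\varepsilon_r(hk)=\varepsilon_r(s_r(\varepsilon_r(h))k)=\varepsilon_r(t_r(\varepsilon_r(h))k)$; (iii) a $\Bbbk$-linear map $S:\mathcal H\to\mathcal H$, such that $s_l\varepsilon_lt_r=t_r$, $t_l\varepsilon_ls_r=s_r$, $s_r\varepsilon_rt_l=t_l$, $t_r\varepsilon_rs_l=s_l$; $(\Delta_l\otimes\mathcal H)\Delta_r=(\mathcal H\otimes\Delta_r)\Delta_l$ and $(\Delta_r\otimes\mathcal H)\Delta_l=(\mathcal H\otimes\Delta_l)\Delta_r$; $S(t_l(a)ht_r(b))=s_r(b)S(h)s_l(a)$; $S(h_{(1)})h_{(2)}=s_r(\varepsilon_r(h))$ and $h^{(1)}S(h^{(2)})=s_l(\varepsilon_l(h))$. Suppose that $s_l=t_r=t$ and $s_r=t_l=s$. A local biretraction of $\mathcal H$ is a $\Bbbk$-linear multiplicative (not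 necessarily unital) map $\alpha:\mathcal H\to A$ such that $\alpha(s(a))=a\,\alpha(1_{\mathcal H})$ for all $a\in A$, and such that there is an (automatically unique) element $e^\alpha\in A$ for which $\alpha(t(e^\alpha))=\alpha(1_{\mathcal H})$ and $\alpha\circ t$ restricts to a bijection $Ae^\alpha\to A\alpha(1_{\mathcal H})$; denote the inverse of this bijection by $(\alpha\circ t)^{-1}$. Then the set $\mathfrak{Brt}(\mathcal H,A)$ of local biretractions is a regular semigroup under the well-defined convolution product $$(\alpha*\beta)(h)=\beta(t(\alpha(h_{(1)})))\,\beta(h_{(2)}).$$ More precisely, this product is associative, and for every $\alpha\in\mathfrak{Brt}(\mathcal H,A)$ the formula $$\alpha^*(h)=(\alpha\circ t)^{-1}\bigl(\varepsilon_l(h^{(1)})\,\alpha(S(h^{(2)}))\bigr)$$ is well defined and gives a local biretraction $\alpha^*$ with $\alpha*\alpha^**\alpha=\alpha$ and $\alpha^**\alpha*\alpha^*=\alpha^*$. -/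

import Mathlib

open scoped TensorProduct

namespace HopfAlgd

section Tensors

variable {k H : Type*} [CommRing k] [Ring H] [Algebra k H]

/-- The relations `P ⊗ H + H ⊗ Q` on `H ⊗ H ⊗ H`, where `P` and `Q` are the relations that are imposed on
the first two and on the last two tensor factors. -/
def tripleRel (P Q : Submodule k (H ⊗[k] H)) : Submodule k ((H ⊗[k] H) ⊗[k] H) :=
  LinearMap.range (TensorProduct.map P.subtype (LinearMap.id : H →ₗ[k] H)) ⊔
    LinearMap.range ((TensorProduct.assoc k H H H).symm.toLinearMap ∘ₗ
      TensorProduct.map (LinearMap.id : H →ₗ[k] H) Q.subtype)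

/-- The iterated tensor product `H ⊗_P H ⊗_Q H`. -/
abbrev Triple (P Q : Submodule k (H ⊗[k] H)) : Type _ := ((H ⊗[k] H) ⊗[k] H) ⧸ tripleRel P Q

/-- The canonical map `(H ⊗_P H) ⊗ H → H ⊗_P H ⊗_Q H`. -/
def joinLeft (P Q : Submodule k (H ⊗[k] H)) : ((H ⊗[k] H) ⧸ P) ⊗[k] H →ₗ[k] Triple P Q :=
  TensorProduct.lift (P.liftQ (TensorProduct.curry (tripleRel P Q).mkQ) (by
    intro x hx
    rw [LinearMap.mem_ker]
    ext m
    change (tripleRel P Q).mkQ (x ⊗ₜ m) = 0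
    rw [Submodule.mkQ_apply, Submodule.Quotient.mk_eq_zero]
    exact Submodule.mem_sup_left ⟨(⟨x, hx⟩ : P) ⊗ₜ m, rfl⟩))

/-- The canonical map `H ⊗ (H ⊗_Q H) → H ⊗_P H ⊗_Q H`. -/
def joinRight (P Q : Submodule k (H ⊗[k] H)) : H ⊗[k] ((H ⊗[k] H) ⧸ Q) →ₗ[k] Triple P Q :=
  TensorProduct.lift (LinearMap.flip (Q.liftQ (LinearMap.flip (TensorProduct.curry
    ((tripleRel P Q).mkQ ∘ₗ (TensorProduct.assoc k H H H).symm.toLinearMap))) (by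
      intro x hx
      rw [LinearMap.mem_ker]
      ext m
      change (tripleRel P Q).mkQ ((TensorProduct.assoc k H H H).symm (m ⊗ₜ x)) = 0
      rw [Submodule.mkQ_apply, Submodule.Quotient.mk_eq_zero]
      exact Submodule.mem_sup_right ⟨m ⊗ₜ (⟨x, hx⟩ : Q), rfl⟩)))

variable {A : Type*} [CommRing A] [Algebra k A]

/-- The relations `t(a) h ⊗ g = h ⊗ s(a) g` that define the tensor square over `A` of the bimodule
`a ▷ h ◁ b = s(a) t(b) h`. -/
def leftRel (s t : A →ₐ[k] H) : Submodule k (H ⊗[k] H) :=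
  Submodule.span k {x | ∃ (a : A) (h g : H), x = (t a * h) ⊗ₜ[k] g - h ⊗ₜ[k] (s a * g)}

/-- The relations `h s(a) ⊗ g = h ⊗ g t(a)` that define the tensor square over `A` of the bimodule
`a ▶ h ◀ b = h t(a) s(b)`. -/
def rightRel (s t : A →ₐ[k] H) : Submodule k (H ⊗[k] H) :=
  Submodule.span k {x | ∃ (a : A) (h g : H), x = (h * s a) ⊗ₜ[k] g - h ⊗ₜ[k] (g * t a)}

end Tensors

/-- A left bialgebroid with total algebra `H` over the commutative `k`-algebra `A` (an antimorphism
`t : A → H` is then the same as a morphism). In each axiom on `Δ h`, the variable `x` (or `y`) runs through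
all representatives in `H ⊗ H` of an element of `H ⊗_A H`; the expression in the axiom depends only on the
class, by the axioms that precede it. -/
structure LeftBialgebroid (k A H : Type*) [CommRing k] [CommRing A] [Algebra k A] [Ring H]
    [Algebra k H] where
  /-- source -/
  s : A →ₐ[k] H
  /-- target -/
  t : A →ₐ[k] H
  s_comm_t : ∀ a b : A, s a * t b = t b * s a
  /-- comultiplication `H → H ⊗_A H` -/
  Δ : H →ₗ[k] (H ⊗[k] H) ⧸ leftRel s t
  /-- counit -/
  ε : H →ₗ[k] A
  /-- `Δ` and `ε` are `A`-bimodule maps -/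
  Δ_bimod : ∀ (a b : A) (h : H) (x : H ⊗[k] H), (leftRel s t).mkQ x = Δ h →
    Δ (s a * t b * h) = (leftRel s t).mkQ ((s a ⊗ₜ[k] t b) * x)
  ε_bimod : ∀ (a b : A) (h : H), ε (s a * t b * h) = a * ε h * b
  /-- coassociativity `(Δ ⊗_A H) ∘ Δ = (H ⊗_A Δ) ∘ Δ` -/
  coassoc : ∀ (h : H) (x : H ⊗[k] H), (leftRel s t).mkQ x = Δ h →
    joinLeft (leftRel s t) (leftRel s t) (TensorProduct.map Δ LinearMap.id x) =
      joinRight (leftRel s t) (leftRel s t) (TensorProduct.map LinearMap.id Δ x)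
  /-- `s(ε(h₁)) h₂ = h` -/
  counit_left : ∀ (h : H) (x : H ⊗[k] H), (leftRel s t).mkQ x = Δ h →
    LinearMap.mul' k H (TensorProduct.map (s.toLinearMap ∘ₗ ε) LinearMap.id x) = h
  /-- `t(ε(h₂)) h₁ = h` -/
  counit_right : ∀ (h : H) (x : H ⊗[k] H), (leftRel s t).mkQ x = Δ h →
    LinearMap.mul' k H (TensorProduct.map (t.toLinearMap ∘ₗ ε) LinearMap.id
      (TensorProduct.comm k H H x)) = h
  /-- `Δ h` lies in the Takeuchi product: `h₁ t(a) ⊗ h₂ = h₁ ⊗ h₂ s(a)` -/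
  takeuchi : ∀ (a : A) (h : H) (x : H ⊗[k] H), (leftRel s t).mkQ x = Δ h →
    (leftRel s t).mkQ (x * (t a ⊗ₜ[k] 1)) = (leftRel s t).mkQ (x * (1 ⊗ₜ[k] s a))
  /-- `Δ` is an algebra morphism to the Takeuchi product -/
  Δ_one : Δ 1 = (leftRel s t).mkQ 1
  Δ_mul : ∀ (h g : H) (x y : H ⊗[k] H), (leftRel s t).mkQ x = Δ h → (leftRel s t).mkQ y = Δ g →
    Δ (h * g) = (leftRel s t).mkQ (x * y)
  ε_mul_s : ∀ h g : H, ε (h * g) = ε (h * s (ε g))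
  ε_mul_t : ∀ h g : H, ε (h * g) = ε (h * t (ε g))

/-- A right bialgebroid with total algebra `H` over the commutative `k`-algebra `A`; the conventions are
those of `LeftBialgebroid`. -/
structure RightBialgebroid (k A H : Type*) [CommRing k] [CommRing A] [Algebra k A] [Ring H]
    [Algebra k H] where
  /-- source -/
  s : A →ₐ[k] H
  /-- target -/
  t : A →ₐ[k] H
  s_comm_t : ∀ a b : A, s a * t b = t b * s a
  /-- comultiplication `H → H ⊗_A H` -/
  Δ : H →ₗ[k] (H ⊗[k] H) ⧸ rightRel s t
  /-- counit -/
  ε : H →ₗ[k] A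
  /-- `Δ` and `ε` are `A`-bimodule maps -/
  Δ_bimod : ∀ (a b : A) (h : H) (x : H ⊗[k] H), (rightRel s t).mkQ x = Δ h →
    Δ (h * t a * s b) = (rightRel s t).mkQ (x * (t a ⊗ₜ[k] s b))
  ε_bimod : ∀ (a b : A) (h : H), ε (h * t a * s b) = a * ε h * b
  /-- coassociativity `(Δ ⊗_A H) ∘ Δ = (H ⊗_A Δ) ∘ Δ` -/
  coassoc : ∀ (h : H) (x : H ⊗[k] H), (rightRel s t).mkQ x = Δ h →
    joinLeft (rightRel s t) (rightRel s t) (TensorProduct.map Δ LinearMap.id x) =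
      joinRight (rightRel s t) (rightRel s t) (TensorProduct.map LinearMap.id Δ x)
  /-- `h² t(ε(h¹)) = h` -/
  counit_left : ∀ (h : H) (x : H ⊗[k] H), (rightRel s t).mkQ x = Δ h →
    LinearMap.mul' k H (TensorProduct.map LinearMap.id (t.toLinearMap ∘ₗ ε)
      (TensorProduct.comm k H H x)) = h
  /-- `h¹ s(ε(h²)) = h` -/
  counit_right : ∀ (h : H) (x : H ⊗[k] H), (rightRel s t).mkQ x = Δ h →
    LinearMap.mul' k H (TensorProduct.map LinearMap.id (s.toLinearMap ∘ₗ ε) x) = h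
  /-- `Δ h` lies in the Takeuchi product: `s(a) h¹ ⊗ h² = h¹ ⊗ t(a) h²` -/
  takeuchi : ∀ (a : A) (h : H) (x : H ⊗[k] H), (rightRel s t).mkQ x = Δ h →
    (rightRel s t).mkQ ((s a ⊗ₜ[k] 1) * x) = (rightRel s t).mkQ ((1 ⊗ₜ[k] t a) * x)
  /-- `Δ` is an algebra morphism to the Takeuchi product -/
  Δ_one : Δ 1 = (rightRel s t).mkQ 1
  Δ_mul : ∀ (h g : H) (x y : H ⊗[k] H), (rightRel s t).mkQ x = Δ h → (rightRel s t).mkQ y = Δ g →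
    Δ (h * g) = (rightRel s t).mkQ (x * y)
  ε_mul_s : ∀ h g : H, ε (h * g) = ε (s (ε h) * g)
  ε_mul_t : ∀ h g : H, ε (h * g) = ε (t (ε h) * g)

section Abbreviations

variable {k A H : Type*} [CommRing k] [CommRing A] [Algebra k A] [Ring H] [Algebra k H]

/-- The relations that define the tensor square over `A` of the left bialgebroid. -/
abbrev LeftBialgebroid.rel (B : LeftBialgebroid k A H) : Submodule k (H ⊗[k] H) := leftRel B.s B.t

/-- The relations that define the tensor square over `A` of the right bialgebroid. -/
abbrev RightBialgebroid.rel (B : RightBialgebroid k A H) : Submodule k (H ⊗[k] H) := rightRel B.s B.t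

end Abbreviations

/-- A Hopf algebroid with total algebra `H`, both of whose bases are the commutative `k`-algebra `A`. As
before, `x` and `y` run through all representatives in `H ⊗ H`. -/
structure HopfAlgebroid (k A H : Type*) [CommRing k] [CommRing A] [Algebra k A] [Ring H]
    [Algebra k H] where
  /-- the left bialgebroid `(H, s_l, t_l, Δ_l, ε_l)` -/
  l : LeftBialgebroid k A H
  /-- the right bialgebroid `(H, s_r, t_r, Δ_r, ε_r)` -/
  r : RightBialgebroid k A H
  /-- antipode -/
  S : H →ₗ[k] H
  sl_εl_tr : ∀ a : A, l.s (l.ε (r.t a)) = r.t a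
  tl_εl_sr : ∀ a : A, l.t (l.ε (r.s a)) = r.s a
  sr_εr_tl : ∀ a : A, r.s (r.ε (l.t a)) = l.t a
  tr_εr_sl : ∀ a : A, r.t (r.ε (l.s a)) = l.s a
  /-- `(Δ_l ⊗ H) ∘ Δ_r = (H ⊗ Δ_r) ∘ Δ_l` -/
  coassoc_lr : ∀ (h : H) (x y : H ⊗[k] H), r.rel.mkQ x = r.Δ h → l.rel.mkQ y = l.Δ h →
    joinLeft l.rel r.rel (TensorProduct.map l.Δ LinearMap.id x) =
      joinRight l.rel r.rel (TensorProduct.map LinearMap.id r.Δ y)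
  /-- `(Δ_r ⊗ H) ∘ Δ_l = (H ⊗ Δ_l) ∘ Δ_r` -/
  coassoc_rl : ∀ (h : H) (x y : H ⊗[k] H), l.rel.mkQ x = l.Δ h → r.rel.mkQ y = r.Δ h →
    joinLeft r.rel l.rel (TensorProduct.map r.Δ LinearMap.id x) =
      joinRight r.rel l.rel (TensorProduct.map LinearMap.id l.Δ y)
  S_bimod : ∀ (a b : A) (h : H), S (l.t a * h * r.t b) = r.s b * S h * l.s a
  /-- `S(h₁) h₂ = s_r(ε_r(h))` -/
  antipode_left : ∀ (h : H) (x : H ⊗[k] H), l.rel.mkQ x = l.Δ h →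
    LinearMap.mul' k H (TensorProduct.map S LinearMap.id x) = r.s (r.ε h)
  /-- `h¹ S(h²) = s_l(ε_l(h))` -/
  antipode_right : ∀ (h : H) (x : H ⊗[k] H), r.rel.mkQ x = r.Δ h →
    LinearMap.mul' k H (TensorProduct.map LinearMap.id S x) = l.s (l.ε h)

section Biretractions

variable {k A H : Type*} [CommRing k] [CommRing A] [Algebra k A] [Ring H] [Algebra k H]

/-- The condition that `α(t(e)) = α(1)` and that `α ∘ t` restricts to a bijection `A e → A α(1)`. -/
def IsDomainIdempotent (t : A →ₐ[k] H) (α : H →ₙₐ[k] A) (e : A) : Prop :=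
  α (t e) = α 1 ∧
    Set.BijOn (fun a => α (t a)) (Ideal.span {e} : Ideal A) (Ideal.span {α 1} : Ideal A)

/-- Local biretractions with respect to the maps `s` and `t`: linear multiplicative (not necessarily unital)
maps `α : H → A` that satisfy (BRT1) and (BRT2). -/
structure IsLocalBiretraction (s t : A →ₐ[k] H) (α : H →ₙₐ[k] A) : Prop where
  brt1 : ∀ a : A, α (s a) = a * α 1
  brt2 : ∃ e : A, IsDomainIdempotent t α e

/-- The set `Brt(H, A)` of local biretractions. -/
abbrev LocalBiretraction (s t : A →ₐ[k] H) : Type _ :=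
  {α : H →ₙₐ[k] A // IsLocalBiretraction s t α}

namespace LocalBiretraction

variable {s t : A →ₐ[k] H}

/-- The element `e^α`. -/
noncomputable def e (α : LocalBiretraction s t) : A := α.2.brt2.choose

theorem e_spec (α : LocalBiretraction s t) : IsDomainIdempotent t α.1 α.e := α.2.brt2.choose_spec

/-- `e^α` is the only element with its defining property. -/
theorem e_unique (α : LocalBiretraction s t) (f : A) (hf : IsDomainIdempotent t α.1 f) : f = α.e := by
  obtain ⟨h1, h2⟩ := hf
  obtain ⟨h3, h4⟩ := α.e_spec
  have hmul : α.1 (t (α.e * f)) = α.1 1 := by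
    rw [map_mul, map_mul, h1, h3, ← map_mul, one_mul]
  have hf : α.e * f = f :=
    h2.injOn (Ideal.mul_mem_left _ _ (Ideal.mem_span_singleton_self f))
      (Ideal.mem_span_singleton_self f) (hmul.trans h1.symm)
  have he : α.e * f = α.e :=
    h4.injOn (Ideal.mul_mem_right _ _ (Ideal.mem_span_singleton_self α.e))
      (Ideal.mem_span_singleton_self α.e) (hmul.trans h3.symm)
  exact hf.symm.trans he

/-- The inverse `(α ∘ t)⁻¹ : A α(1) → A e^α` of the restriction of `α ∘ t`. -/
noncomputable def tInv (α : LocalBiretraction s t) :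
    (Ideal.span {α.1 1} : Ideal A) → (Ideal.span {α.e} : Ideal A) :=
  (Set.BijOn.equiv _ α.e_spec.2).symm

/-- The map `h ⊗ g ↦ β(t(α(h))) β(g)`. -/
noncomputable def convMap (α β : LocalBiretraction s t) : H ⊗[k] H →ₗ[k] A :=
  LinearMap.mul' k A ∘ₗ TensorProduct.map
    ((β.1 : H →ₗ[k] A) ∘ₗ t.toLinearMap ∘ₗ (α.1 : H →ₗ[k] A)) (β.1 : H →ₗ[k] A)

/-- The map `h ⊗ g ↦ ε_l(h) α(S(g))`. -/
noncomputable def antipodeMap (𝓗 : HopfAlgebroid k A H) (α : LocalBiretraction s t) : H ⊗[k] H →ₗ[k] A :=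
  LinearMap.mul' k A ∘ₗ TensorProduct.map 𝓗.l.ε ((α.1 : H →ₗ[k] A) ∘ₗ 𝓗.S)

theorem antipodeMap_mem (𝓗 : HopfAlgebroid k A H) (α : LocalBiretraction s t) (x : H ⊗[k] H) :
    antipodeMap 𝓗 α x ∈ (Ideal.span {α.1 1} : Ideal A) := by
  induction x with
  | zero => simp
  | add x y hx hy => rw [map_add]; exact add_mem hx hy
  | tmul h g =>
    change 𝓗.l.ε h * α.1 (𝓗.S g) ∈ _
    have h1 : α.1 (𝓗.S g) = α.1 (𝓗.S g) * α.1 1 := by rw [← map_mul, mul_one]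
    rw [h1, ← mul_assoc]
    exact Ideal.mul_mem_left _ _ (Ideal.mem_span_singleton_self _)

end LocalBiretraction

end Biretractions

end HopfAlgd

/-! Every identity is obtained by applying a product of maps `H → A` to a coassociativity law, once
those maps respect the relations over `A`. Restricted along `t`, convolution becomes composition,
`(α * β) ∘ t = (β ∘ t) ∘ (α ∘ t)`; this gives associativity and indicates that `α* ∘ t` should
invert `α ∘ t`.

The main obstacle is the multiplicativity of `α*`: neither the multiplicativity of the counits nor
the antimultiplicativity of `S` is an axiom. Both are recovered after applying `α`. From `α(S(h₁))
α(h₂) = ε_r(h) α(1)` the right counit is multiplicative up to the factor `α(1)`, and `ε_r ∘ S = ε_l`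
transfers this to the left one. For `α ∘ S`, the mixed coassociativity law shows that right
convolution with `α` can be cancelled (`eq_zero_of_conv_eq_zero`); two cancellations, one per
argument, give `antip_mul`.

The mixed coassociativity laws then yield `(α * α*)(h) = ε_l(h) e^α` and `(α* * α)(h) = ε_l(h)
α(1)`. The next factor composed with `t` does not see `e^α`, respectively `α(1)`, so the left counit
law gives both regularity identities. -/

namespace HopfAlgd

/-! ### Products of linear maps on balanced tensor products -/

section Convolution

variable {k A H : Type*} [CommRing k] [CommRing A] [Algebra k A] [Ring H] [Algebra k H]

/-- The map `x ⊗ y ↦ f(x) g(y)`. -/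
noncomputable def conv (f g : H →ₗ[k] A) : H ⊗[k] H →ₗ[k] A :=
  LinearMap.mul' k A ∘ₗ TensorProduct.map f g

@[simp]
theorem conv_tmul (f g : H →ₗ[k] A) (h h' : H) : conv f g (h ⊗ₜ h') = f h * g h' := rfl

theorem leftRel_le_ker_conv {s t : A →ₐ[k] H} {f g : H →ₗ[k] A}
    (hfg : ∀ a h h', f (t a * h) * g h' = f h * g (s a * h')) :
    leftRel s t ≤ LinearMap.ker (conv f g) := by
  refine Submodule.span_le.2 ?_
  rintro _ ⟨a, h, h', rfl⟩
  simp [hfg]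

theorem rightRel_le_ker_conv {s t : A →ₐ[k] H} {f g : H →ₗ[k] A}
    (hfg : ∀ a h h', f (h * s a) * g h' = f h * g (h' * t a)) :
    rightRel s t ≤ LinearMap.ker (conv f g) := by
  refine Submodule.span_le.2 ?_
  rintro _ ⟨a, h, h', rfl⟩
  simp [hfg]

theorem eq_of_mkQ_eq {M N : Type*} [AddCommGroup M] [Module k M] [AddCommGroup N] [Module k N]
    {P : Submodule k M} {f : M →ₗ[k] N} (hf : P ≤ LinearMap.ker f) {x y : M}
    (hxy : P.mkQ x = P.mkQ y) : f x = f y := by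
  rw [← sub_eq_zero, ← map_sub]
  exact hf ((Submodule.Quotient.eq P).1 hxy)

/-- The triple relations are generated by `P ⊗ H` and `H ⊗ Q`. The first is killed by `conv f g`;
the second by `conv g e`, after rebracketing the product in `A`. -/
theorem tripleRel_le_ker {P Q : Submodule k (H ⊗[k] H)} {f g e : H →ₗ[k] A}
    (hP : P ≤ LinearMap.ker (conv f g)) (hQ : Q ≤ LinearMap.ker (conv g e)) :
    tripleRel P Q ≤ LinearMap.ker (LinearMap.mul' k A ∘ₗ TensorProduct.map (conv f g) e) := by
  refine sup_le ?_ ?_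
  · rw [LinearMap.range_le_ker_iff]
    refine TensorProduct.ext' fun x h => ?_
    change conv f g x * e h = 0
    rw [LinearMap.mem_ker.1 (hP x.2), zero_mul]
  · rw [LinearMap.range_le_ker_iff]
    refine TensorProduct.ext' fun h x => ?_
    have key : (LinearMap.mul' k A ∘ₗ TensorProduct.map (conv f g) e) ∘ₗ
        (TensorProduct.assoc k H H H).symm.toLinearMap ∘ₗ TensorProduct.mk k H (H ⊗[k] H) h =
        LinearMap.mulLeft k (f h) ∘ₗ conv g e :=
      TensorProduct.ext' fun a b => mul_assoc (f h) (g a) (e b)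
    refine (DFunLike.congr_fun key (x : H ⊗[k] H)).trans ?_
    change f h * conv g e x = 0
    rw [LinearMap.mem_ker.1 (hQ x.2), mul_zero]

/-- Coassociativity, evaluated at `f ⊗ g ⊗ e`. -/
theorem conv_eq_conv_of_join_eq {P Q : Submodule k (H ⊗[k] H)} {f g e fg ge : H →ₗ[k] A}
    (hP : P ≤ LinearMap.ker (conv f g)) (hQ : Q ≤ LinearMap.ker (conv g e))
    {ΔP : H →ₗ[k] (H ⊗[k] H) ⧸ P} {ΔQ : H →ₗ[k] (H ⊗[k] H) ⧸ Q}
    (hfg : ∀ h z, P.mkQ z = ΔP h → conv f g z = fg h)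
    (hge : ∀ h z, Q.mkQ z = ΔQ h → conv g e z = ge h) {x y : H ⊗[k] H}
    (hxy : joinLeft P Q (TensorProduct.map ΔP LinearMap.id x) =
      joinRight P Q (TensorProduct.map LinearMap.id ΔQ y)) :
    conv fg e x = conv f ge y := by
  have hle := tripleRel_le_ker hP hQ
  -- Both sides come from the single functional `f ⊗ g ⊗ e` on the triple tensor product, pulled
  -- back along the two joins. Any representative `z` serves, since `hfg` and `hge` cover them all.
  have h1 : ((tripleRel P Q).liftQ _ hle) ∘ₗ joinLeft P Q ∘ₗ TensorProduct.map ΔP LinearMap.id =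
      conv fg e := by
    refine TensorProduct.ext' fun a b => ?_
    obtain ⟨z, hz⟩ := P.mkQ_surjective (ΔP a)
    rw [conv_tmul, ← hfg a z hz]
    change ((tripleRel P Q).liftQ _ hle) (joinLeft P Q (ΔP a ⊗ₜ b)) = _
    rw [← hz]
    rfl
  have h2 : ((tripleRel P Q).liftQ _ hle) ∘ₗ joinRight P Q ∘ₗ TensorProduct.map LinearMap.id ΔQ =
      conv f ge := by
    refine TensorProduct.ext' fun a b => ?_
    obtain ⟨z, hz⟩ := Q.mkQ_surjective (ΔQ b)
    rw [conv_tmul, ← hge b z hz]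
    change ((tripleRel P Q).liftQ _ hle) (joinRight P Q (a ⊗ₜ ΔQ b)) = _
    rw [← hz]
    have key : (LinearMap.mul' k A ∘ₗ TensorProduct.map (conv f g) e) ∘ₗ
        (TensorProduct.assoc k H H H).symm.toLinearMap ∘ₗ TensorProduct.mk k H (H ⊗[k] H) a =
        LinearMap.mulLeft k (f a) ∘ₗ conv g e :=
      TensorProduct.ext' fun b c => mul_assoc (f a) (g b) (e c)
    exact DFunLike.congr_fun key z
  rw [← h1, ← h2]
  exact congrArg ((tripleRel P Q).liftQ _ hle) hxy

theorem conv_mul {f g : H →ₗ[k] A}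
    (hfg : ∀ h h' g₁ g₂, f (h * h') * g (g₁ * g₂) = (f h * g g₁) * (f h' * g g₂)) (x y : H ⊗[k] H) :
    conv f g (x * y) = conv f g x * conv f g y := by
  induction x with
  | zero => simp
  | add x x' hx hx' => rw [add_mul, map_add, map_add, hx, hx', add_mul]
  | tmul a b =>
    induction y with
    | zero => simp
    | add y y' hy hy' => rw [mul_add, map_add, map_add, hy, hy', mul_add]
    | tmul c d => simp [hfg]

theorem conv_mul_tmul (f g : H →ₗ[k] A) (x : H ⊗[k] H) (a b : H) :
    conv f g (x * (a ⊗ₜ b)) =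
      conv (f ∘ₗ LinearMap.mulRight k a) (g ∘ₗ LinearMap.mulRight k b) x := by
  induction x with
  | zero => simp
  | add x x' hx hx' => rw [add_mul, map_add, map_add, hx, hx']
  | tmul h h' => simp

theorem conv_tmul_mul (f g : H →ₗ[k] A) (x : H ⊗[k] H) (a b : H) :
    conv f g ((a ⊗ₜ b) * x) =
      conv (f ∘ₗ LinearMap.mulLeft k a) (g ∘ₗ LinearMap.mulLeft k b) x := by
  induction x with
  | zero => simp
  | add x x' hx hx' => rw [mul_add, map_add, map_add, hx, hx']
  | tmul h h' => simp

theorem conv_eq_mul {f g f' g' : H →ₗ[k] A} {c : A}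
    (h : ∀ a b, f a * g b = c * (f' a * g' b)) (x : H ⊗[k] H) : conv f g x = c * conv f' g' x := by
  induction x with
  | zero => simp
  | add x x' hx hx' => rw [map_add, map_add, hx, hx', mul_add]
  | tmul a b => simp [h]

theorem conv_sub_left (f f' g : H →ₗ[k] A) : conv (f - f') g = conv f g - conv f' g :=
  TensorProduct.ext' fun a b => sub_mul (f a) (f' a) (g b)

end Convolution

/-! ### Consequences of the axioms when the source and target maps coincide crosswise -/

/-- The maps `s = s_r = t_l` and `t = s_l = t_r` are the structure maps of the Hopf algebroid. -/
structure HopfAlgebroid.IsStructureMaps {k A H : Type*} [CommRing k] [CommRing A] [Algebra k A]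
    [Ring H] [Algebra k H] (𝓗 : HopfAlgebroid k A H) (s t : A →ₐ[k] H) : Prop where
  ls : 𝓗.l.s = t
  rt : 𝓗.r.t = t
  rs : 𝓗.r.s = s
  lt : 𝓗.l.t = s

namespace HopfAlgebroid.IsStructureMaps

variable {k A H : Type*} [CommRing k] [CommRing A] [Algebra k A] [Ring H] [Algebra k H]
  {𝓗 : HopfAlgebroid k A H} {s t : A →ₐ[k] H}

theorem left_le_ker (hst : 𝓗.IsStructureMaps s t) {f g : H →ₗ[k] A}
    (hfg : ∀ a h h', f (s a * h) * g h' = f h * g (t a * h')) :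
    𝓗.l.rel ≤ LinearMap.ker (conv f g) :=
  leftRel_le_ker_conv (by rwa [hst.ls, hst.lt])

theorem right_le_ker (hst : 𝓗.IsStructureMaps s t) {f g : H →ₗ[k] A}
    (hfg : ∀ a h h', f (h * s a) * g h' = f h * g (h' * t a)) :
    𝓗.r.rel ≤ LinearMap.ker (conv f g) :=
  rightRel_le_ker_conv (by rwa [hst.rs, hst.rt])

theorem εl_t_mul (hst : 𝓗.IsStructureMaps s t) (a : A) (h : H) :
    𝓗.l.ε (t a * h) = a * 𝓗.l.ε h := by
  simpa [hst.ls] using 𝓗.l.ε_bimod a 1 h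

theorem εl_s_mul (hst : 𝓗.IsStructureMaps s t) (a : A) (h : H) :
    𝓗.l.ε (s a * h) = a * 𝓗.l.ε h := by
  simpa [hst.lt, mul_comm] using 𝓗.l.ε_bimod 1 a h

theorem εr_mul_t (hst : 𝓗.IsStructureMaps s t) (a : A) (h : H) :
    𝓗.r.ε (h * t a) = a * 𝓗.r.ε h := by
  simpa [hst.rt] using 𝓗.r.ε_bimod a 1 h

theorem S_s_mul (hst : 𝓗.IsStructureMaps s t) (a : A) (h : H) : 𝓗.S (s a * h) = 𝓗.S h * t a := by
  simpa [hst.ls, hst.lt] using 𝓗.S_bimod a 1 h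

theorem S_mul_t (hst : 𝓗.IsStructureMaps s t) (a : A) (h : H) : 𝓗.S (h * t a) = s a * 𝓗.S h := by
  simpa [hst.rs, hst.rt] using 𝓗.S_bimod 1 a h

/-- `ε_l(1) = 1` is not among the axioms. Its image under `s` is enough later, because `α(s(a)) = a
α(1)`. -/
theorem s_εl_one (hst : 𝓗.IsStructureMaps s t) : s (𝓗.l.ε 1) = 1 := by
  simpa [hst.lt, hst.rs] using 𝓗.tl_εl_sr 1

theorem s_εr_one (hst : 𝓗.IsStructureMaps s t) : s (𝓗.r.ε 1) = 1 := by
  simpa [hst.lt, hst.rs] using 𝓗.sr_εr_tl 1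

theorem εl_mul_εr_one (hst : 𝓗.IsStructureMaps s t) (h : H) : 𝓗.l.ε h * 𝓗.r.ε 1 = 𝓗.l.ε h := by
  rw [mul_comm, ← hst.εl_s_mul, hst.s_εr_one, one_mul]

theorem S_one (hst : 𝓗.IsStructureMaps s t) : 𝓗.S 1 = 1 := by
  have := 𝓗.antipode_left 1 1 𝓗.l.Δ_one.symm
  rw [Algebra.TensorProduct.one_def] at this
  simpa [hst.rs, hst.s_εr_one] using this

/-- The counits are related by the antipode. -/
theorem εr_S (hst : 𝓗.IsStructureMaps s t) (h : H) : 𝓗.r.ε (𝓗.S h) = 𝓗.l.ε h := by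
  obtain ⟨x, hx⟩ := 𝓗.r.rel.mkQ_surjective (𝓗.r.Δ h)
  have h1 := congrArg 𝓗.r.ε (𝓗.antipode_right h x hx)
  have h2 := congrArg (fun g => 𝓗.r.ε (𝓗.S g)) (𝓗.r.counit_left h x hx)
  -- Write `h = h² t(ε_r(h¹))`. The antipode turns the right factor into a left factor `s(ε_r(h¹))`,
  -- which `ε_r` does not distinguish from `h¹`; what remains is `ε_r(h¹ S(h²)) = ε_r(t(ε_l(h)))`.
  have key : 𝓗.r.ε ∘ₗ LinearMap.mul' k H ∘ₗ TensorProduct.map LinearMap.id 𝓗.S =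
      (𝓗.r.ε ∘ₗ 𝓗.S) ∘ₗ LinearMap.mul' k H ∘ₗ
        TensorProduct.map LinearMap.id (𝓗.r.t.toLinearMap ∘ₗ 𝓗.r.ε) ∘ₗ
          (TensorProduct.comm k H H).toLinearMap := by
    refine TensorProduct.ext' fun a b => ?_
    change 𝓗.r.ε (a * 𝓗.S b) = 𝓗.r.ε (𝓗.S (b * 𝓗.r.t (𝓗.r.ε a)))
    rw [𝓗.r.ε_mul_s, hst.rs, hst.rt, hst.S_mul_t]
  have h3 := DFunLike.congr_fun key x
  rw [← hst.εl_mul_εr_one, ← hst.εr_mul_t, one_mul, ← hst.ls, ← h1, ← h2]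
  exact h3.symm

theorem Δl_s_mul (hst : 𝓗.IsStructureMaps s t) (a : A) {h : H} {x : H ⊗[k] H}
    (hx : 𝓗.l.rel.mkQ x = 𝓗.l.Δ h) : 𝓗.l.rel.mkQ ((1 ⊗ₜ s a) * x) = 𝓗.l.Δ (s a * h) := by
  simpa [hst.lt] using (𝓗.l.Δ_bimod 1 a h x hx).symm

theorem Δl_t (hst : 𝓗.IsStructureMaps s t) (a : A) :
    𝓗.l.rel.mkQ (t a ⊗ₜ 1) = 𝓗.l.Δ (t a) := by
  have := 𝓗.l.Δ_bimod a 1 1 1 𝓗.l.Δ_one.symm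
  simpa [hst.ls] using this.symm

theorem Δl_s (hst : 𝓗.IsStructureMaps s t) (a : A) :
    𝓗.l.rel.mkQ (1 ⊗ₜ s a) = 𝓗.l.Δ (s a) := by
  have := hst.Δl_s_mul a 𝓗.l.Δ_one.symm
  simpa using this

theorem Δr_t (hst : 𝓗.IsStructureMaps s t) (a : A) :
    𝓗.r.rel.mkQ (t a ⊗ₜ 1) = 𝓗.r.Δ (t a) := by
  have := 𝓗.r.Δ_bimod a 1 1 1 𝓗.r.Δ_one.symm
  simpa [hst.rt] using this.symm

theorem Δr_s (hst : 𝓗.IsStructureMaps s t) (a : A) :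
    𝓗.r.rel.mkQ (1 ⊗ₜ s a) = 𝓗.r.Δ (s a) := by
  have := 𝓗.r.Δ_bimod 1 a 1 1 𝓗.r.Δ_one.symm
  simpa [hst.rs] using this.symm

theorem takeuchi_left (hst : 𝓗.IsStructureMaps s t) (a : A) {h : H} {x : H ⊗[k] H}
    (hx : 𝓗.l.rel.mkQ x = 𝓗.l.Δ h) :
    𝓗.l.rel.mkQ (x * (s a ⊗ₜ 1)) = 𝓗.l.rel.mkQ (x * (1 ⊗ₜ t a)) := by
  have h1 : s a = 𝓗.l.t a := by rw [hst.lt]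
  have h2 : t a = 𝓗.l.s a := by rw [hst.ls]
  rw [h1, h2, 𝓗.l.takeuchi a h x hx]

/-- `E(h₁) φ(ε_l(h₂)) = E(h)` -/
theorem conv_εl_right (hst : 𝓗.IsStructureMaps s t) {E : H →ₗ[k] A} {φ : A →ₗ[k] A}
    (hE : ∀ a h, E (s a * h) = φ a * E h) {h : H} {x : H ⊗[k] H}
    (hx : 𝓗.l.rel.mkQ x = 𝓗.l.Δ h) : conv E (φ ∘ₗ 𝓗.l.ε) x = E h := by
  have key : E ∘ₗ LinearMap.mul' k H ∘ₗ TensorProduct.map (𝓗.l.t.toLinearMap ∘ₗ 𝓗.l.ε) LinearMap.id ∘ₗ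
      (TensorProduct.comm k H H).toLinearMap = conv E (φ ∘ₗ 𝓗.l.ε) := by
    refine TensorProduct.ext' fun a b => ?_
    change E (𝓗.l.t (𝓗.l.ε b) * a) = E a * φ (𝓗.l.ε b)
    rw [hst.lt, hE, mul_comm]
  rw [← key]
  exact congrArg E (𝓗.l.counit_right h x hx)

/-- `φ(ε_l(h₁)) E(h₂) = E(h)` -/
theorem conv_εl_left (hst : 𝓗.IsStructureMaps s t) {E : H →ₗ[k] A} {φ : A →ₗ[k] A}
    (hE : ∀ a h, E (t a * h) = φ a * E h) {h : H} {x : H ⊗[k] H}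
    (hx : 𝓗.l.rel.mkQ x = 𝓗.l.Δ h) : conv (φ ∘ₗ 𝓗.l.ε) E x = E h := by
  have key : E ∘ₗ LinearMap.mul' k H ∘ₗ
      TensorProduct.map (𝓗.l.s.toLinearMap ∘ₗ 𝓗.l.ε) LinearMap.id = conv (φ ∘ₗ 𝓗.l.ε) E := by
    refine TensorProduct.ext' fun a b => ?_
    change E (𝓗.l.s (𝓗.l.ε a) * b) = φ (𝓗.l.ε a) * E b
    rw [hst.ls, hE]
  rw [← key]
  exact congrArg E (𝓗.l.counit_left h x hx)

/-- `E(h¹ s(ε_r(h²))) = E(h)` -/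
theorem conv_εr_right (hst : 𝓗.IsStructureMaps s t) {E F : H →ₗ[k] A}
    (hE : ∀ h g, E (h * s (𝓗.r.ε g)) = E h * F g) {h : H} {x : H ⊗[k] H}
    (hx : 𝓗.r.rel.mkQ x = 𝓗.r.Δ h) : conv E F x = E h := by
  have key : E ∘ₗ LinearMap.mul' k H ∘ₗ
      TensorProduct.map LinearMap.id (𝓗.r.s.toLinearMap ∘ₗ 𝓗.r.ε) = conv E F := by
    refine TensorProduct.ext' fun a b => ?_
    change E (a * 𝓗.r.s (𝓗.r.ε b)) = E a * F b
    rw [hst.rs, hE]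
  rw [← key]
  exact congrArg E (𝓗.r.counit_right h x hx)

end HopfAlgebroid.IsStructureMaps

/-! ### Multiplicativity of the counits and of `α ∘ S` -/

namespace LocalBiretraction

variable {k A H : Type*} [CommRing k] [CommRing A] [Algebra k A] [Ring H] [Algebra k H]
  {𝓗 : HopfAlgebroid k A H} {s t : A →ₐ[k] H}

/-- A local biretraction as a linear map. -/
def lin (α : LocalBiretraction s t) : H →ₗ[k] A := (α.1 : H →ₗ[k] A)

/-- The composite `α ∘ t`. -/
def base (α : LocalBiretraction s t) : A →ₗ[k] A := α.lin ∘ₗ t.toLinearMap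

/-- The composite `α ∘ S`. -/
def antip (𝓗 : HopfAlgebroid k A H) (α : LocalBiretraction s t) : H →ₗ[k] A := α.lin ∘ₗ 𝓗.S

theorem ext_lin {α β : LocalBiretraction s t} (h : ∀ g, α.lin g = β.lin g) : α = β :=
  Subtype.ext (NonUnitalAlgHom.ext h)

theorem lin_mul (α : LocalBiretraction s t) (h g : H) : α.lin (h * g) = α.lin h * α.lin g :=
  map_mul α.1 h g

theorem lin_mul_one (α : LocalBiretraction s t) (h : H) : α.lin h * α.lin 1 = α.lin h := by
  rw [← lin_mul, mul_one]

theorem lin_s (α : LocalBiretraction s t) (a : A) : α.lin (s a) = a * α.lin 1 := α.2.brt1 a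

theorem lin_t (α : LocalBiretraction s t) (a : A) : α.lin (t a) = α.base a := rfl

theorem lin_s_mul (α : LocalBiretraction s t) (a : A) (h : H) : α.lin (s a * h) = a * α.lin h := by
  rw [lin_mul, lin_s, mul_assoc, ← lin_mul, one_mul]

theorem lin_mul_s (α : LocalBiretraction s t) (a : A) (h : H) : α.lin (h * s a) = a * α.lin h := by
  rw [lin_mul, mul_comm, ← lin_mul, lin_s_mul]

theorem base_mul (α : LocalBiretraction s t) (a b : A) :
    α.base (a * b) = α.base a * α.base b := by
  rw [← lin_t, map_mul, lin_mul]; rfl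

theorem base_one (α : LocalBiretraction s t) : α.base 1 = α.lin 1 := by
  rw [← lin_t, map_one]

theorem base_mul_one (α : LocalBiretraction s t) (a : A) : α.base a * α.lin 1 = α.base a :=
  α.lin_mul_one _

theorem antip_s_mul (hst : 𝓗.IsStructureMaps s t) (α : LocalBiretraction s t) (a : A) (h : H) :
    α.antip 𝓗 (s a * h) = α.base a * α.antip 𝓗 h := by
  change α.lin (𝓗.S _) = _ * α.lin (𝓗.S h)
  rw [hst.S_s_mul, lin_mul, mul_comm]; rfl

theorem antip_mul_t (hst : 𝓗.IsStructureMaps s t) (α : LocalBiretraction s t) (a : A) (h : H) :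
    α.antip 𝓗 (h * t a) = a * α.antip 𝓗 h := by
  change α.lin (𝓗.S _) = _ * α.lin (𝓗.S h)
  rw [hst.S_mul_t, lin_s_mul]

theorem antip_mul_one (α : LocalBiretraction s t) (h : H) :
    α.antip 𝓗 h * α.lin 1 = α.antip 𝓗 h := α.lin_mul_one _

theorem antip_one (hst : 𝓗.IsStructureMaps s t) (α : LocalBiretraction s t) :
    α.antip 𝓗 1 = α.lin 1 := congrArg α.lin hst.S_one

theorem conv_antip_lin (hst : 𝓗.IsStructureMaps s t) (α : LocalBiretraction s t) {h : H}
    {x : H ⊗[k] H} (hx : 𝓗.l.rel.mkQ x = 𝓗.l.Δ h) :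
    conv (α.antip 𝓗) α.lin x = 𝓗.r.ε h * α.lin 1 := by
  have key : α.lin ∘ₗ LinearMap.mul' k H ∘ₗ TensorProduct.map 𝓗.S LinearMap.id =
      conv (α.antip 𝓗) α.lin := TensorProduct.ext' fun a b => α.lin_mul _ _
  have h1 := 𝓗.antipode_left h x hx
  rw [hst.rs] at h1
  rw [← key, ← lin_s]
  exact congrArg α.lin h1

theorem conv_lin_antip (hst : 𝓗.IsStructureMaps s t) (α : LocalBiretraction s t) {h : H}
    {x : H ⊗[k] H} (hx : 𝓗.r.rel.mkQ x = 𝓗.r.Δ h) :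
    conv α.lin (α.antip 𝓗) x = α.base (𝓗.l.ε h) := by
  have key : α.lin ∘ₗ LinearMap.mul' k H ∘ₗ TensorProduct.map LinearMap.id 𝓗.S =
      conv α.lin (α.antip 𝓗) := TensorProduct.ext' fun a b => α.lin_mul _ _
  have h1 := 𝓗.antipode_right h x hx
  rw [hst.ls] at h1
  rw [← key, ← lin_t]
  exact congrArg α.lin h1

/-- Since `Δ_l(s(a) h) = h₁ ⊗ s(a) h₂`, the scalar can be pulled out of the second factor of
`α(S(h₁)) α(h₂) = ε_r(h) α(1)`. The factor `α(1)` is the price of arguing through `α`. -/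
theorem εr_s_mul (hst : 𝓗.IsStructureMaps s t) (α : LocalBiretraction s t) (a : A) (h : H) :
    𝓗.r.ε (s a * h) * α.lin 1 = a * 𝓗.r.ε h * α.lin 1 := by
  obtain ⟨x, hx⟩ := 𝓗.l.rel.mkQ_surjective (𝓗.l.Δ h)
  rw [← α.conv_antip_lin hst (hst.Δl_s_mul a hx), mul_assoc, ← α.conv_antip_lin hst hx,
    conv_tmul_mul]
  refine conv_eq_mul (fun h g => ?_) x
  simp only [LinearMap.comp_apply, LinearMap.mulLeft_apply, one_mul, lin_s_mul]
  ring

theorem εr_mul (hst : 𝓗.IsStructureMaps s t) (α : LocalBiretraction s t) (h g : H) :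
    𝓗.r.ε (h * g) * α.lin 1 = 𝓗.r.ε h * 𝓗.r.ε g * α.lin 1 := by
  rw [𝓗.r.ε_mul_s, hst.rs, α.εr_s_mul hst]

/-- The previous property of `ε_r` passes to `ε_l = ε_r ∘ S`, because `S(h t(a)) = s(a) S(h)`. -/
theorem εl_mul_t (hst : 𝓗.IsStructureMaps s t) (α : LocalBiretraction s t) (a : A) (h : H) :
    𝓗.l.ε (h * t a) * α.lin 1 = a * 𝓗.l.ε h * α.lin 1 := by
  rw [← hst.εr_S, hst.S_mul_t, α.εr_s_mul hst, hst.εr_S]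

theorem εl_mul (hst : 𝓗.IsStructureMaps s t) (α : LocalBiretraction s t) (h g : H) :
    𝓗.l.ε (h * g) * α.lin 1 = 𝓗.l.ε h * 𝓗.l.ε g * α.lin 1 := by
  rw [𝓗.l.ε_mul_s, hst.ls, α.εl_mul_t hst, mul_comm (𝓗.l.ε g)]

theorem εl_one_mul (hst : 𝓗.IsStructureMaps s t) (α : LocalBiretraction s t) :
    𝓗.l.ε 1 * α.lin 1 = α.lin 1 := by
  rw [← lin_s, hst.s_εl_one]

theorem εl_mul_s (hst : 𝓗.IsStructureMaps s t) (α : LocalBiretraction s t) (a : A) (h : H) :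
    𝓗.l.ε (h * s a) * α.lin 1 = a * 𝓗.l.ε h * α.lin 1 := by
  have h1 := hst.εl_s_mul a 1
  rw [mul_one] at h1
  rw [α.εl_mul hst, h1, mul_assoc, mul_assoc, α.εl_one_mul hst]
  ring

theorem left_le_ker_conv_lin (hst : 𝓗.IsStructureMaps s t) (α : LocalBiretraction s t)
    {E : H →ₗ[k] A} (hE : ∀ a h, E (s a * h) = α.base a * E h) :
    𝓗.l.rel ≤ LinearMap.ker (conv E α.lin) :=
  hst.left_le_ker fun a h h' => by rw [hE, lin_mul, lin_t]; ring

theorem right_le_ker_conv_lin_antip (hst : 𝓗.IsStructureMaps s t) (α : LocalBiretraction s t) :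
    𝓗.r.rel ≤ LinearMap.ker (conv α.lin (α.antip 𝓗)) :=
  hst.right_le_ker fun a h h' => by rw [lin_mul_s, α.antip_mul_t hst]; ring

/-- Convolution with `α` from the right is injective on maps that are semilinear along `α ∘ t`. -/
theorem eq_zero_of_conv_eq_zero (hst : 𝓗.IsStructureMaps s t) (α : LocalBiretraction s t)
    {E : H →ₗ[k] A} (hE : ∀ a h, E (s a * h) = α.base a * E h)
    (h0 : ∀ h x, 𝓗.l.rel.mkQ x = 𝓗.l.Δ h → conv E α.lin x = 0) (h : H) : E h = 0 := by
  obtain ⟨x, hx⟩ := 𝓗.r.rel.mkQ_surjective (𝓗.r.Δ h)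
  obtain ⟨y, hy⟩ := 𝓗.l.rel.mkQ_surjective (𝓗.l.Δ h)
  -- Evaluate `E ⊗ α ⊗ (α ∘ S)` on the mixed coassociativity law. One side contains `E * α`, hence
  -- vanishes; on the other, `α(h₂¹) α(S(h₂²)) = α(t(ε_l(h₂)))`, so semilinearity and the counit law
  -- return `E(h)`.
  have h1 := conv_eq_conv_of_join_eq (fg := 0) (ge := α.base ∘ₗ 𝓗.l.ε)
    (α.left_le_ker_conv_lin hst hE) (α.right_le_ker_conv_lin_antip hst) h0
    (fun h z hz => α.conv_lin_antip hst hz) (𝓗.coassoc_lr h x y hx hy)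
  rw [hst.conv_εl_right hE hy] at h1
  rw [← h1]
  have : conv 0 (α.antip 𝓗) = 0 := TensorProduct.ext' fun a b => zero_mul _
  rw [this, LinearMap.zero_apply]

/-- After convolution with `α`, the Takeuchi condition moves `s(a)` from the first leg to `t(a)` in
the second, where `α` turns it into the scalar `α(t(a))`. This supplies the semilinearity in the
second argument that `antip_mul` needs in order to cancel. -/
theorem antip_mul_s_mul (hst : 𝓗.IsStructureMaps s t) (α : LocalBiretraction s t) (a : A) (h g : H) :
    α.antip 𝓗 (h * (s a * g)) = α.base a * α.antip 𝓗 (h * g) := by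
  rw [← sub_eq_zero]
  refine α.eq_zero_of_conv_eq_zero hst (E := α.antip 𝓗 ∘ₗ LinearMap.mulRight k (s a * g) -
    LinearMap.mulLeft k (α.base a) ∘ₗ α.antip 𝓗 ∘ₗ LinearMap.mulRight k g)
    (fun b h => ?_) (fun h x hx => ?_) h
  · simp only [LinearMap.sub_apply, LinearMap.comp_apply, LinearMap.mulRight_apply,
      LinearMap.mulLeft_apply, mul_assoc (s b), α.antip_s_mul hst]
    ring
  · have h1 := eq_of_mkQ_eq (α.left_le_ker_conv_lin hst
      (E := α.antip 𝓗 ∘ₗ LinearMap.mulRight k g) fun b h => by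
        simp only [LinearMap.comp_apply, LinearMap.mulRight_apply, mul_assoc, α.antip_s_mul hst])
      (hst.takeuchi_left a hx)
    rw [conv_sub_left, LinearMap.sub_apply, sub_eq_zero]
    rw [conv_mul_tmul, conv_mul_tmul] at h1
    have h2 : LinearMap.mulRight k g ∘ₗ LinearMap.mulRight k (s a) =
        LinearMap.mulRight k (s a * g) := LinearMap.ext fun x => mul_assoc x (s a) g
    rw [LinearMap.comp_assoc, h2, LinearMap.mulRight_one, LinearMap.comp_id, LinearMap.comp_id] at h1
    rw [h1, conv_eq_mul (f' := α.antip 𝓗 ∘ₗ LinearMap.mulRight k g) (g' := α.lin) (c := α.base a),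
      ← conv_eq_mul (f' := α.antip 𝓗 ∘ₗ LinearMap.mulRight k g) (g' := α.lin) (c := α.base a)]
    · intro b c
      simp only [LinearMap.comp_apply, LinearMap.mulLeft_apply, mul_assoc]
    · intro b c
      simp only [LinearMap.comp_apply, LinearMap.mulRight_apply, lin_mul, lin_t]
      ring

/-- Cancellation in the variable `h`: convolving the left side with `α` assembles `α(S((hg)₁))
α((hg)₂) = ε_r(hg) α(1)`, and `ε_r` is multiplicative up to `α(1)`. -/
theorem conv_antip_mulLeft_lin (hst : 𝓗.IsStructureMaps s t) (α : LocalBiretraction s t) (h g : H)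
    (y : H ⊗[k] H) (hy : 𝓗.l.rel.mkQ y = 𝓗.l.Δ g) :
    conv (α.antip 𝓗 ∘ₗ LinearMap.mulLeft k h) α.lin y = α.antip 𝓗 h * 𝓗.r.ε g := by
  -- The representative `y` of `Δ_l g` stays fixed, and the sum is regarded as a linear map of `h`.
  let F : H →ₗ[k] A :=
    { toFun := fun h => conv (α.antip 𝓗 ∘ₗ LinearMap.mulLeft k h) α.lin y
      map_add' := fun h h' => by
        rw [← LinearMap.add_apply]
        congr 1
        refine TensorProduct.ext' fun a b => ?_
        simp [add_mul]
      map_smul' := fun c h => by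
        rw [RingHom.id_apply, ← LinearMap.smul_apply]
        congr 1
        refine TensorProduct.ext' fun a b => ?_
        simp }
  have hF : ∀ h, F h = conv (α.antip 𝓗 ∘ₗ LinearMap.mulLeft k h) α.lin y := fun _ => rfl
  rw [← hF, ← sub_eq_zero]
  refine α.eq_zero_of_conv_eq_zero hst (E := F - LinearMap.mulRight k (𝓗.r.ε g) ∘ₗ α.antip 𝓗)
    (fun b h => ?_) (fun h x hx => ?_) h
  · simp only [LinearMap.sub_apply, LinearMap.comp_apply, LinearMap.mulRight_apply,
      α.antip_s_mul hst, mul_sub, ← mul_assoc]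
    congr 1
    refine conv_eq_mul (fun a c => ?_) y
    simp only [LinearMap.comp_apply, LinearMap.mulLeft_apply, mul_assoc, α.antip_s_mul hst]
  · have h1 : conv F α.lin x = conv (α.antip 𝓗) α.lin (x * y) := by
      have key : conv F α.lin = conv (α.antip 𝓗) α.lin ∘ₗ LinearMap.mulRight k y := by
        refine TensorProduct.ext' fun a b => ?_
        rw [conv_tmul, LinearMap.comp_apply, LinearMap.mulRight_apply, conv_tmul_mul, mul_comm]
        refine (conv_eq_mul (fun c d => ?_) y).symm
        simp only [LinearMap.comp_apply, LinearMap.mulLeft_apply, lin_mul]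
        ring
      exact DFunLike.congr_fun key x
    have h2 := α.conv_antip_lin hst (𝓗.l.Δ_mul h g x y hx hy).symm
    rw [conv_sub_left, LinearMap.sub_apply, sub_eq_zero, h1, h2, α.εr_mul hst,
      conv_eq_mul (f' := α.antip 𝓗) (g' := α.lin) (c := 𝓗.r.ε g), α.conv_antip_lin hst hx]
    · ring
    · intro a b
      simp only [LinearMap.comp_apply, LinearMap.mulRight_apply]
      ring

/-- The composite `α ∘ S` is multiplicative. -/
theorem antip_mul (hst : 𝓗.IsStructureMaps s t) (α : LocalBiretraction s t) (h g : H) :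
    α.antip 𝓗 (h * g) = α.antip 𝓗 h * α.antip 𝓗 g := by
  rw [← sub_eq_zero]
  -- Now cancel in `g` with `h` fixed: both terms convolve with `α` to `α(S(h)) ε_r(g)`.
  refine α.eq_zero_of_conv_eq_zero hst (E := α.antip 𝓗 ∘ₗ LinearMap.mulLeft k h -
    LinearMap.mulLeft k (α.antip 𝓗 h) ∘ₗ α.antip 𝓗) (fun b g => ?_) (fun g y hy => ?_) g
  · simp only [LinearMap.sub_apply, LinearMap.comp_apply, LinearMap.mulLeft_apply,
      α.antip_mul_s_mul hst, α.antip_s_mul hst]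
    ring
  · rw [conv_sub_left, LinearMap.sub_apply, sub_eq_zero, α.conv_antip_mulLeft_lin hst h g y hy,
      conv_eq_mul (f' := α.antip 𝓗) (g' := α.lin) (c := α.antip 𝓗 h), α.conv_antip_lin hst hy]
    · rw [mul_left_comm, antip_mul_one, mul_comm]
    · intro a b
      simp only [LinearMap.comp_apply, LinearMap.mulLeft_apply]
      ring

end LocalBiretraction

/-- A multiplicative linear map as a morphism of non-unital algebras. -/
def nonUnitalAlgHomOfLinear {k A H : Type*} [CommRing k] [CommRing A] [Algebra k A] [Ring H]
    [Algebra k H] (f : H →ₗ[k] A) (hf : ∀ h g, f (h * g) = f h * f g) : H →ₙₐ[k] A :=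
  { f with
    map_zero' := map_zero f
    map_mul' := hf }

/-! ### The partial inverse of `α ∘ t` -/

namespace LocalBiretraction

variable {k A H : Type*} [CommRing k] [CommRing A] [Algebra k A] [Ring H] [Algebra k H]
  {𝓗 : HopfAlgebroid k A H} {s t : A →ₐ[k] H}

/-- The image lies in `A α(1)` automatically, as `α(t(a)) = α(t(a)) α(1)`. By additivity,
injectivity on `A e` is a statement about the kernel. -/
theorem isDomainIdempotent_of {α : H →ₙₐ[k] A} {e : A} (h1 : α (t e) = α 1)
    (hinj : ∀ a, α (t (a * e)) = 0 → a * e = 0) (hsurj : ∀ b, ∃ a, α (t (a * e)) = b * α 1) :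
    IsDomainIdempotent t α e := by
  refine ⟨h1, fun a _ => ?_, fun a ha b hb hab => ?_, fun b hb => ?_⟩
  · refine Ideal.mem_span_singleton'.2 ⟨α (t a), ?_⟩
    rw [← map_mul, mul_one]
  · obtain ⟨a, rfl⟩ := Ideal.mem_span_singleton'.1 ha
    obtain ⟨b, rfl⟩ := Ideal.mem_span_singleton'.1 hb
    rw [← sub_eq_zero, ← sub_mul]
    refine hinj _ ?_
    rw [sub_mul, map_sub, map_sub, sub_eq_zero]
    exact hab
  · obtain ⟨b, rfl⟩ := Ideal.mem_span_singleton'.1 hb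
    obtain ⟨a, ha⟩ := hsurj b
    exact ⟨a * e, Ideal.mul_mem_left _ _ (Ideal.mem_span_singleton_self e), ha⟩

theorem base_e (α : LocalBiretraction s t) : α.base α.e = α.lin 1 := α.e_spec.1

theorem base_mul_e (α : LocalBiretraction s t) (a : A) : α.base (a * α.e) = α.base a := by
  rw [base_mul, base_e, base_mul_one]

/-- Multiplication by `e^α` maps into `A e^α` without changing the value of `α ∘ t`, which is
injective there. -/
theorem eq_of_base_eq (α : LocalBiretraction s t) {a b : A} (h : α.base a = α.base b) :
    a * α.e = b * α.e := by
  refine α.e_spec.2.injOn (Ideal.mul_mem_left _ _ (Ideal.mem_span_singleton_self _))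
    (Ideal.mul_mem_left _ _ (Ideal.mem_span_singleton_self _)) ?_
  change α.base _ = α.base _
  rw [base_mul_e, base_mul_e, h]

theorem e_mul_e (α : LocalBiretraction s t) : α.e * α.e = α.e := by
  have := α.eq_of_base_eq (a := α.e) (b := 1) (by rw [base_e, base_one])
  rwa [one_mul] at this

theorem tInv_mul_e (α : LocalBiretraction s t) (b : (Ideal.span {α.1 1} : Ideal A)) :
    (α.tInv b : A) * α.e = α.tInv b := by
  obtain ⟨a, ha⟩ := Ideal.mem_span_singleton'.1 (α.tInv b).2
  rw [← ha, mul_assoc, e_mul_e]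

theorem base_tInv (α : LocalBiretraction s t) (b : (Ideal.span {α.1 1} : Ideal A)) :
    α.base (α.tInv b) = b :=
  congrArg Subtype.val ((Set.BijOn.equiv _ α.e_spec.2).apply_symm_apply b)

theorem tInv_eq (α : LocalBiretraction s t) {b : (Ideal.span {α.1 1} : Ideal A)} {c : A}
    (hc : c * α.e = c) (h : α.base c = b) : (α.tInv b : A) = c := by
  rw [← tInv_mul_e, ← hc]
  exact α.eq_of_base_eq ((α.base_tInv b).trans h.symm)

/-- The map `b ↦ (α ∘ t)⁻¹(b α(1))`. -/
noncomputable def baseInv (α : LocalBiretraction s t) : A →ₗ[k] A where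
  toFun b := α.tInv ⟨b * α.lin 1, Ideal.mul_mem_left _ _ (Ideal.mem_span_singleton_self _)⟩
  map_add' a b := α.tInv_eq (by rw [add_mul, tInv_mul_e, tInv_mul_e])
    (by rw [map_add, base_tInv, base_tInv]; exact (add_mul _ _ _).symm)
  map_smul' c b := α.tInv_eq (by rw [RingHom.id_apply, smul_mul_assoc, tInv_mul_e])
    (by rw [RingHom.id_apply, map_smul, base_tInv]; exact (smul_mul_assoc _ _ _).symm)

theorem baseInv_mul_e (α : LocalBiretraction s t) (b : A) :
    α.baseInv b * α.e = α.baseInv b := α.tInv_mul_e _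

theorem base_baseInv (α : LocalBiretraction s t) (b : A) :
    α.base (α.baseInv b) = b * α.lin 1 := α.base_tInv _

theorem baseInv_eq (α : LocalBiretraction s t) {b c : A} (hc : c * α.e = c)
    (h : α.base c = b * α.lin 1) : α.baseInv b = c := α.tInv_eq hc h

theorem lin_one_mul_lin_one (α : LocalBiretraction s t) : α.lin 1 * α.lin 1 = α.lin 1 :=
  α.lin_mul_one 1

theorem tInv_eq_baseInv (α : LocalBiretraction s t) (b : (Ideal.span {α.1 1} : Ideal A)) :
    (α.tInv b : A) = α.baseInv b := by
  obtain ⟨b, hb⟩ := b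
  obtain ⟨a, rfl⟩ := Ideal.mem_span_singleton'.1 hb
  refine α.tInv_eq (α.baseInv_mul_e _) ?_
  rw [base_baseInv]
  change a * α.lin 1 * α.lin 1 = a * α.lin 1
  rw [mul_assoc, lin_one_mul_lin_one]

theorem baseInv_mul (α : LocalBiretraction s t) (a b : A) :
    α.baseInv (a * b) = α.baseInv a * α.baseInv b := by
  refine α.baseInv_eq (by rw [mul_assoc, baseInv_mul_e]) ?_
  rw [base_mul, base_baseInv, base_baseInv, mul_mul_mul_comm, lin_one_mul_lin_one]

theorem baseInv_base (α : LocalBiretraction s t) (a : A) : α.baseInv (α.base a) = a * α.e :=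
  α.baseInv_eq (by rw [mul_assoc, e_mul_e]) (by rw [base_mul_e, base_mul_one])

theorem baseInv_mul_one (α : LocalBiretraction s t) (a : A) :
    α.baseInv (a * α.lin 1) = α.baseInv a :=
  α.baseInv_eq (α.baseInv_mul_e a) (by rw [base_baseInv, mul_assoc, lin_one_mul_lin_one])

/-! ### The convolution product -/

theorem left_le_ker_conv_base (hst : 𝓗.IsStructureMaps s t) (α β : LocalBiretraction s t) :
    𝓗.l.rel ≤ LinearMap.ker (conv (β.base ∘ₗ α.lin) β.lin) :=
  β.left_le_ker_conv_lin hst fun a h => by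
    rw [LinearMap.comp_apply, lin_s_mul, base_mul, LinearMap.comp_apply]

/-- The convolution product as a linear map. -/
noncomputable def convLin (hst : 𝓗.IsStructureMaps s t) (α β : LocalBiretraction s t) : H →ₗ[k] A :=
  𝓗.l.rel.liftQ _ (left_le_ker_conv_base hst α β) ∘ₗ 𝓗.l.Δ

theorem convLin_eq (hst : 𝓗.IsStructureMaps s t) (α β : LocalBiretraction s t) {h : H} {x : H ⊗[k] H}
    (hx : 𝓗.l.rel.mkQ x = 𝓗.l.Δ h) : convLin hst α β h = conv (β.base ∘ₗ α.lin) β.lin x := by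
  rw [convLin, LinearMap.comp_apply, ← hx]
  rfl

theorem convLin_mul (hst : 𝓗.IsStructureMaps s t) (α β : LocalBiretraction s t) (h g : H) :
    convLin hst α β (h * g) = convLin hst α β h * convLin hst α β g := by
  obtain ⟨x, hx⟩ := 𝓗.l.rel.mkQ_surjective (𝓗.l.Δ h)
  obtain ⟨y, hy⟩ := 𝓗.l.rel.mkQ_surjective (𝓗.l.Δ g)
  rw [convLin_eq hst α β (𝓗.l.Δ_mul h g x y hx hy).symm, convLin_eq hst α β hx,
    convLin_eq hst α β hy]
  refine conv_mul (fun a b c d => ?_) x y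
  simp only [LinearMap.comp_apply, lin_mul, base_mul]
  ring

theorem convLin_s (hst : 𝓗.IsStructureMaps s t) (α β : LocalBiretraction s t) (a : A) :
    convLin hst α β (s a) = a * β.base (α.lin 1) := by
  rw [convLin_eq hst α β (hst.Δl_s a), conv_tmul, lin_s, LinearMap.comp_apply, mul_left_comm,
    base_mul_one]

theorem convLin_t (hst : 𝓗.IsStructureMaps s t) (α β : LocalBiretraction s t) (a : A) :
    convLin hst α β (t a) = β.base (α.base a) := by
  rw [convLin_eq hst α β (hst.Δl_t a), conv_tmul, LinearMap.comp_apply, base_mul_one, lin_t]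

theorem convLin_one (hst : 𝓗.IsStructureMaps s t) (α β : LocalBiretraction s t) :
    convLin hst α β 1 = β.base (α.lin 1) := by
  simpa using convLin_s hst α β 1

/-- The convolution product of local biretractions. -/
noncomputable def convProd (hst : 𝓗.IsStructureMaps s t) (α β : LocalBiretraction s t) :
    LocalBiretraction s t where
  val := nonUnitalAlgHomOfLinear (convLin hst α β) (convLin_mul hst α β)
  property :=
    { brt1 := fun a => by
        change convLin hst α β (s a) = a * convLin hst α β 1
        rw [convLin_s, convLin_one]
      brt2 := by
        -- As `(α * β) ∘ t` is `α ∘ t` followed by `β ∘ t`, its domain idempotent is that of `β` cut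
        -- down to `A α(1)` and pulled back along `α ∘ t`.
        refine ⟨α.baseInv β.e, isDomainIdempotent_of ?_ (fun a ha => ?_) fun b => ?_⟩
        · change convLin hst α β _ = convLin hst α β 1
          rw [convLin_t, convLin_one, base_baseInv, mul_comm, base_mul_e]
        · change convLin hst α β _ = 0 at ha
          have h1 := β.eq_of_base_eq (b := 0) (by rw [← convLin_t hst, ha, map_zero])
          rw [base_mul, base_baseInv, zero_mul, mul_assoc, mul_right_comm, e_mul_e,
            ← base_baseInv, ← base_mul] at h1
          have h2 := α.eq_of_base_eq (b := 0) (by rw [h1, map_zero])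
          rwa [zero_mul, mul_assoc, baseInv_mul_e] at h2
        · refine ⟨α.baseInv (β.baseInv b), ?_⟩
          change convLin hst α β _ = b * convLin hst α β 1
          rw [convLin_t, convLin_one, ← baseInv_mul, base_baseInv, base_mul, base_mul_e,
            base_baseInv, mul_assoc, mul_comm (β.lin 1), base_mul_one] }

theorem lin_convProd (hst : 𝓗.IsStructureMaps s t) (α β : LocalBiretraction s t) {h : H}
    {x : H ⊗[k] H} (hx : 𝓗.l.rel.mkQ x = 𝓗.l.Δ h) :
    (convProd hst α β).lin h = conv (β.base ∘ₗ α.lin) β.lin x := convLin_eq hst α β hx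

theorem base_convProd (hst : 𝓗.IsStructureMaps s t) (α β : LocalBiretraction s t) (a : A) :
    (convProd hst α β).base a = β.base (α.base a) := convLin_t hst α β a

/-- Both bracketings evaluate one functional `f ⊗ g ⊗ γ` on iterated `Δ_l`, with `f = (γ ∘ t) ∘ (β ∘
t) ∘ α` and `g = (γ ∘ t) ∘ β`. -/
theorem convProd_assoc (hst : 𝓗.IsStructureMaps s t) (α β γ : LocalBiretraction s t) :
    convProd hst (convProd hst α β) γ = convProd hst α (convProd hst β γ) := by
  refine ext_lin fun h => ?_
  obtain ⟨x, hx⟩ := 𝓗.l.rel.mkQ_surjective (𝓗.l.Δ h)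
  rw [lin_convProd hst _ _ hx, lin_convProd hst _ _ hx]
  refine conv_eq_conv_of_join_eq (g := γ.base ∘ₗ β.lin)
    (hst.left_le_ker fun a h g => ?_) (left_le_ker_conv_base hst β γ) (fun h z hz => ?_)
    (fun h z hz => (lin_convProd hst β γ hz).symm) (𝓗.l.coassoc h x hx)
  · simp only [LinearMap.comp_apply, base_convProd, lin_s_mul, lin_mul β, lin_t, base_mul]
    ring
  · rw [LinearMap.comp_apply, lin_convProd hst α β hz]
    have key : γ.base ∘ₗ conv (β.base ∘ₗ α.lin) β.lin =
        conv ((convProd hst β γ).base ∘ₗ α.lin) (γ.base ∘ₗ β.lin) := by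
      refine TensorProduct.ext' fun a b => ?_
      simp only [LinearMap.comp_apply, conv_tmul, base_mul, base_convProd]
    rw [← key, LinearMap.comp_apply]

/-! ### The generalized inverse and regularity -/

/-- The rule `ε_l(h s(a)) = a ε_l(h)` is known only up to `α(1)`; the missing factor is hidden in
`α(S(h')) = α(S(h')) α(1)`. -/
theorem right_le_ker_conv_εl_antip (hst : 𝓗.IsStructureMaps s t) (α : LocalBiretraction s t) :
    𝓗.r.rel ≤ LinearMap.ker (conv 𝓗.l.ε (α.antip 𝓗)) :=
  hst.right_le_ker fun a h h' => by
    rw [α.antip_mul_t hst, ← α.antip_mul_one h']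
    linear_combination α.antip 𝓗 h' * α.εl_mul_s hst a h

/-- The map `h ↦ ε_l(h¹) α(S(h²))`. -/
noncomputable def antipLin (hst : 𝓗.IsStructureMaps s t) (α : LocalBiretraction s t) : H →ₗ[k] A :=
  𝓗.r.rel.liftQ _ (α.right_le_ker_conv_εl_antip hst) ∘ₗ 𝓗.r.Δ

theorem antipLin_eq (hst : 𝓗.IsStructureMaps s t) (α : LocalBiretraction s t) {h : H} {x : H ⊗[k] H}
    (hx : 𝓗.r.rel.mkQ x = 𝓗.r.Δ h) : antipLin hst α h = conv 𝓗.l.ε (α.antip 𝓗) x := by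
  rw [antipLin, LinearMap.comp_apply, ← hx]
  rfl

theorem antipLin_mul (hst : 𝓗.IsStructureMaps s t) (α : LocalBiretraction s t) (h g : H) :
    antipLin hst α (h * g) = antipLin hst α h * antipLin hst α g := by
  obtain ⟨x, hx⟩ := 𝓗.r.rel.mkQ_surjective (𝓗.r.Δ h)
  obtain ⟨y, hy⟩ := 𝓗.r.rel.mkQ_surjective (𝓗.r.Δ g)
  rw [antipLin_eq hst α (𝓗.r.Δ_mul h g x y hx hy).symm, antipLin_eq hst α hx,
    antipLin_eq hst α hy]
  refine conv_mul (fun a b c d => ?_) x y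
  rw [α.antip_mul hst, ← α.antip_mul_one c]
  linear_combination α.antip 𝓗 c * α.antip 𝓗 d * α.εl_mul hst a b

theorem antipLin_mul_one (hst : 𝓗.IsStructureMaps s t) (α : LocalBiretraction s t) (h : H) :
    antipLin hst α h * α.lin 1 = antipLin hst α h := by
  obtain ⟨x, hx⟩ := 𝓗.r.rel.mkQ_surjective (𝓗.r.Δ h)
  rw [antipLin_eq hst α hx, mul_comm]
  refine (conv_eq_mul (fun a b => ?_) x).symm
  rw [mul_left_comm, mul_comm (α.lin 1), antip_mul_one]

theorem antipLin_s (hst : 𝓗.IsStructureMaps s t) (α : LocalBiretraction s t) (a : A) :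
    antipLin hst α (s a) = α.base a := by
  rw [antipLin_eq hst α (hst.Δr_s a), conv_tmul, ← mul_one (s a), α.antip_s_mul hst,
    α.antip_one hst, mul_left_comm, α.εl_one_mul hst, base_mul_one]

theorem antipLin_one (hst : 𝓗.IsStructureMaps s t) (α : LocalBiretraction s t) :
    antipLin hst α 1 = α.lin 1 := by
  rw [← base_one, ← antipLin_s hst, map_one s]

theorem antipLin_t (hst : 𝓗.IsStructureMaps s t) (α : LocalBiretraction s t) (a : A) :
    antipLin hst α (t a) = a * α.lin 1 := by
  rw [antipLin_eq hst α (hst.Δr_t a), conv_tmul, ← mul_one (t a), hst.εl_t_mul,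
    α.antip_one hst, mul_assoc, α.εl_one_mul hst]

/-- The generalized inverse `α*` of a local biretraction. -/
noncomputable def star (hst : 𝓗.IsStructureMaps s t) (α : LocalBiretraction s t) :
    LocalBiretraction s t where
  val := nonUnitalAlgHomOfLinear (α.baseInv ∘ₗ antipLin hst α) fun h g => by
    rw [LinearMap.comp_apply, antipLin_mul, baseInv_mul]; rfl
  property :=
    { brt1 := fun a => by
        change α.baseInv (antipLin hst α (s a)) = a * α.baseInv (antipLin hst α 1)
        rw [antipLin_s, antipLin_one, ← base_one, baseInv_base, baseInv_base, one_mul]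
      brt2 := by
        -- Passing to the inverse exchanges the two idempotents: `α* ∘ t` inverts `α ∘ t`, its
        -- domain idempotent is `α(1)`, and `α*(1) = e^α`. Hence `α(t(b))` is a preimage of `b e^α`.
        refine ⟨α.lin 1, isDomainIdempotent_of ?_ (fun a ha => ?_) fun b => ⟨α.base b, ?_⟩⟩
        · change α.baseInv (antipLin hst α _) = α.baseInv (antipLin hst α 1)
          rw [antipLin_t, antipLin_one, baseInv_mul_one]
        · change α.baseInv (antipLin hst α _) = 0 at ha
          have h1 := α.base_baseInv (antipLin hst α (t (a * α.lin 1)))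
          rw [ha, map_zero, antipLin_t, mul_assoc, mul_assoc, lin_one_mul_lin_one,
            lin_one_mul_lin_one] at h1
          exact h1.symm
        · change α.baseInv (antipLin hst α _) = b * α.baseInv (antipLin hst α 1)
          rw [antipLin_t, antipLin_one, baseInv_mul_one, baseInv_mul_one, ← base_one, baseInv_base,
            baseInv_base, one_mul] }

theorem lin_star (hst : 𝓗.IsStructureMaps s t) (α : LocalBiretraction s t) (h : H) :
    (star hst α).lin h = α.baseInv (antipLin hst α h) := rfl

theorem base_star (hst : 𝓗.IsStructureMaps s t) (α : LocalBiretraction s t) (a : A) :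
    (star hst α).base a = α.baseInv a := by
  rw [← lin_t, lin_star, antipLin_t, baseInv_mul_one]

/-- Before `(α ∘ t)⁻¹` is applied, the product is `α(h₁) ε_l(h₂¹) α(S(h₂²))`. Mixed coassociativity
and the left bialgebroid's counit law reduce it to `α(h¹) α(S(h²)) = α(t(ε_l(h)))`. -/
theorem lin_convProd_star (hst : 𝓗.IsStructureMaps s t) (α : LocalBiretraction s t) (h : H) :
    (convProd hst α (star hst α)).lin h = 𝓗.l.ε h * α.e := by
  obtain ⟨x, hx⟩ := 𝓗.r.rel.mkQ_surjective (𝓗.r.Δ h)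
  obtain ⟨y, hy⟩ := 𝓗.l.rel.mkQ_surjective (𝓗.l.Δ h)
  have h1 := conv_eq_conv_of_join_eq (f := α.lin) (g := 𝓗.l.ε) (fg := α.lin)
    (ge := antipLin hst α)
    (hst.left_le_ker fun a h g => by rw [lin_s_mul, hst.εl_t_mul]; ring)
    (α.right_le_ker_conv_εl_antip hst)
    (fun h z hz => hst.conv_εl_right (φ := LinearMap.id) α.lin_s_mul hz)
    (fun h z hz => (antipLin_eq hst α hz).symm) (𝓗.coassoc_lr h x y hx hy)
  rw [α.conv_lin_antip hst hx] at h1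
  have key : conv ((star hst α).base ∘ₗ α.lin) (star hst α).lin =
      α.baseInv ∘ₗ conv α.lin (antipLin hst α) := by
    refine TensorProduct.ext' fun a b => ?_
    rw [conv_tmul, LinearMap.comp_apply, LinearMap.comp_apply, conv_tmul, baseInv_mul, base_star,
      lin_star]
  rw [lin_convProd hst _ _ hy, key, LinearMap.comp_apply, ← h1, baseInv_base]

/-- Here `α ∘ t` undoes `(α ∘ t)⁻¹`, leaving `ε_l(h₁¹) α(S(h₁²)) α(h₂)`. The other mixed law gives
`ε_l(h¹) ε_r(h²) α(1)`, and the right bialgebroid's counit law removes `ε_r`. -/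
theorem lin_star_convProd (hst : 𝓗.IsStructureMaps s t) (α : LocalBiretraction s t) (h : H) :
    (convProd hst (star hst α) α).lin h = 𝓗.l.ε h * α.lin 1 := by
  obtain ⟨x, hx⟩ := 𝓗.r.rel.mkQ_surjective (𝓗.r.Δ h)
  obtain ⟨y, hy⟩ := 𝓗.l.rel.mkQ_surjective (𝓗.l.Δ h)
  have h1 := conv_eq_conv_of_join_eq (f := 𝓗.l.ε) (fg := antipLin hst α)
    (ge := LinearMap.mulRight k (α.lin 1) ∘ₗ 𝓗.r.ε)
    (α.right_le_ker_conv_εl_antip hst) (α.left_le_ker_conv_lin hst (α.antip_s_mul hst))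
    (fun h z hz => (antipLin_eq hst α hz).symm) (fun h z hz => α.conv_antip_lin hst hz)
    (𝓗.coassoc_rl h y x hy hx)
  have h2 : α.base ∘ₗ (star hst α).lin = antipLin hst α := by
    ext h
    rw [LinearMap.comp_apply, lin_star, base_baseInv, antipLin_mul_one]
  rw [lin_convProd hst _ _ hy, h2, h1]
  have h3 := hst.conv_εr_right (E := LinearMap.mulRight k (α.lin 1) ∘ₗ 𝓗.l.ε) (F := 𝓗.r.ε)
    (fun h g => ?_) hx
  · refine Eq.trans ?_ h3
    have key : conv 𝓗.l.ε (LinearMap.mulRight k (α.lin 1) ∘ₗ 𝓗.r.ε) =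
        conv (LinearMap.mulRight k (α.lin 1) ∘ₗ 𝓗.l.ε) 𝓗.r.ε := by
      refine TensorProduct.ext' fun a b => ?_
      simp only [conv_tmul, LinearMap.comp_apply, LinearMap.mulRight_apply]
      ring
    rw [key]
  · simp only [LinearMap.comp_apply, LinearMap.mulRight_apply, α.εl_mul_s hst]
    ring

theorem convProd_star_convProd (hst : 𝓗.IsStructureMaps s t) (α : LocalBiretraction s t) :
    convProd hst (convProd hst α (star hst α)) α = α := by
  refine ext_lin fun h => ?_
  obtain ⟨x, hx⟩ := 𝓗.l.rel.mkQ_surjective (𝓗.l.Δ h)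
  have h1 : α.base ∘ₗ (convProd hst α (star hst α)).lin = α.base ∘ₗ 𝓗.l.ε := by
    ext h
    rw [LinearMap.comp_apply, lin_convProd_star, base_mul_e, LinearMap.comp_apply]
  rw [lin_convProd hst _ _ hx, h1]
  exact hst.conv_εl_left (fun a h => by rw [lin_mul, lin_t]) hx

theorem star_convProd_star (hst : 𝓗.IsStructureMaps s t) (α : LocalBiretraction s t) :
    convProd hst (convProd hst (star hst α) α) (star hst α) = star hst α := by
  refine ext_lin fun h => ?_
  obtain ⟨x, hx⟩ := 𝓗.l.rel.mkQ_surjective (𝓗.l.Δ h)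
  have h1 : (star hst α).base ∘ₗ (convProd hst (star hst α) α).lin =
      (star hst α).base ∘ₗ 𝓗.l.ε := by
    ext h
    rw [LinearMap.comp_apply, lin_star_convProd, base_star, baseInv_mul_one, LinearMap.comp_apply,
      base_star]
  rw [lin_convProd hst _ _ hx, h1]
  exact hst.conv_εl_left (fun a h => by rw [lin_mul, lin_t]) hx

end LocalBiretraction

end HopfAlgd

theorem mainTheorem3 {k A H : Type*} [Field k] [CharZero k] [CommRing A] [Algebra k A] [Ring H]
    [Algebra k H] (𝓗 : HopfAlgd.HopfAlgebroid k A H) (s t : A →ₐ[k] H)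
    (hsl : 𝓗.l.s = t) (htr : 𝓗.r.t = t) (hsr : 𝓗.r.s = s) (htl : 𝓗.l.t = s) :
    ∃ _ : Semigroup (HopfAlgd.LocalBiretraction s t),
      (∀ (α β : HopfAlgd.LocalBiretraction s t) (h : H) (x : H ⊗[k] H),
        𝓗.l.rel.mkQ x = 𝓗.l.Δ h → (α * β).1 h = α.convMap β x) ∧
      ∀ α : HopfAlgd.LocalBiretraction s t, ∃ α' : HopfAlgd.LocalBiretraction s t,
        (∀ (h : H) (x : H ⊗[k] H), 𝓗.r.rel.mkQ x = 𝓗.r.Δ h →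
          α'.1 h = (α.tInv ⟨α.antipodeMap 𝓗 x, α.antipodeMap_mem 𝓗 x⟩ : A)) ∧
        α * α' * α = α ∧ α' * α * α' = α' := by
  have hst : 𝓗.IsStructureMaps s t := ⟨hsl, htr, hsr, htl⟩
  refine ⟨{ mul := HopfAlgd.LocalBiretraction.convProd hst
            mul_assoc := HopfAlgd.LocalBiretraction.convProd_assoc hst },
    fun α β h x hx => HopfAlgd.LocalBiretraction.lin_convProd hst α β hx, fun α =>
    ⟨HopfAlgd.LocalBiretraction.star hst α, fun h x hx => ?_,
      HopfAlgd.LocalBiretraction.convProd_star_convProd hst α,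
      HopfAlgd.LocalBiretraction.star_convProd_star hst α⟩⟩
  rw [α.tInv_eq_baseInv]
  exact congrArg α.baseInv (HopfAlgd.LocalBiretraction.antipLin_eq hst α hx)
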